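/- An algebraic formula over a field $\mathbb{F}$ in the variables $x_1,\dots,x_n$ is a finite rooted tree whose leaves are labelled by elements of $\mathbb{F}$ or by variables and whose internal nodes are sum gates or product gates (of arbitrary finite fan-in); it computes a polynomial in $\mathbb{F}[x_1,\dots,x_n]$ in the obvious way, and its size is the number of its leaves that are not labelled by constants. For $0\le d\le n$ let $e_d^n=\sum_{S\subseteq\{1,\dots,n\},\,|S|=d}\ \prod_{i\in S}x_i$ be the elementary symmetric polynomial of degree $d$ in $n$ variables. There is an absolute constant $c>0$ such that for every field $\mathbb{F}$ (of any characteristic) and all integers $0\le d\le n$, every algebraic formula over $\mathbb{F}$ that computes $e_d^n$ has size at least $c\,d(n-d)$. That is, every algebraic formula computing $e_d^n$ over an arbitrary field has size $\Omega(d(n-d))$. -/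

import Mathlib

/-- Algebraic formulas over a commutative (semi)ring `F` in the variables `x_i`, `i : σ`: finite
rooted trees whose leaves are labelled by constants of `F` or by variables, and whose internal nodes
are sum gates or product gates of arbitrary finite fan-in. -/
inductive AlgFormula (F : Type*) (σ : Type*) where
  /-- a leaf labelled by a constant -/
  | const (a : F) : AlgFormula F σ
  /-- a leaf labelled by a variable -/
  | var (i : σ) : AlgFormula F σ
  /-- a sum gate with `k` children -/
  | sum (k : ℕ) (child : Fin k → AlgFormula F σ) : AlgFormula F σ
  /-- a product gate with `k` children -/
  | prod (k : ℕ) (child : Fin k → AlgFormula F σ) : AlgFormula F σ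

namespace AlgFormula

/-- The polynomial computed by a formula. -/
noncomputable def eval {F σ : Type*} [CommSemiring F] : AlgFormula F σ → MvPolynomial σ F
  | const a => MvPolynomial.C a
  | var i => MvPolynomial.X i
  | sum _ child => ∑ j, (child j).eval
  | prod _ child => ∏ j, (child j).eval

/-- The size of a formula: the number of leaves whose label is not a constant. It is at most the
number of all leaves, and at most the number of all nodes, so a lower bound on it is a lower bound
on these as well. -/
def size {F σ : Type*} : AlgFormula F σ → ℕ
  | const _ => 0
  | var _ => 1
  | sum _ child => ∑ j, (child j).size
  | prod _ child => ∑ j, (child j).size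

/-- The formula `Φ` computes the polynomial `f` (as a formal polynomial, not as a function). -/
def Computes {F σ : Type*} [CommSemiring F] (Φ : AlgFormula F σ) (f : MvPolynomial σ F) : Prop :=
  Φ.eval = f

end AlgFormula

/-!
A formula with few leaves is a short sum of products plus a polynomial of small degree, and
`esymm d` is not, because its partial derivatives cut out a set of small dimension.

For `2 ≤ d` put `t = d / 2`. A formula of size `s` computes a polynomial `∑ A_i B_i + g` with at
most `s / t` products, where all `A_i` and `B_i` vanish at the origin and `g` has degree below
`2 * t ≤ d` (`AlgFormula.hasProductDecomposition_eval` and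
`HasProductDecomposition.exists_constantCoeff_eq_zero`). This goes by induction on the formula: the
remainder has degree at most the number of leaves not yet paid for, and when a product gate makes
that number reach `t`, the remainder minus its constant term becomes a new factor. It is essential
that only the constant term is left behind, so that each `B_i` vanishes at the origin; as `B_i` has
degree below `2 * t`, the constant term of `A_i` can be moved into `g` at the end.

If `esymm d = ∑ A_i B_i + g`, then the ideal generated by the `A_i` and `B_i` contains all partial
derivatives of `esymm d - g`. Modulo `esymm 1, …, esymm (d - 1)`, the derivative of `esymm d` with
respect to `X j` is `(-X j) ^ (d - 1)` (`MvPolynomial.pderiv_esymm_sub_mem`), in every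
characteristic. So the ideal generated by the `A_i`, the `B_i` and `esymm 1, …, esymm (d - 1)`
contains, for each `j`, a polynomial `X j ^ (d - 1) - r_j` with `r_j` of degree below `d - 1`, which
makes its quotient finite-dimensional. All the generators vanish at the origin, so by Krull's height
theorem there are at least `n` of them (`MvPolynomial.le_card_of_finite_quotient`), that is,
`n - d + 1` is at most twice the number of products, hence at most `2 * s / t`.
-/

open MvPolynomial

/-! ### The derivatives of elementary symmetric polynomials -/

section Esymm

variable {σ R : Type*} [Fintype σ] [CommRing R]

/-- Splitting the squarefree monomials of degree `m + 1` according to whether they contain `X j`;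
the sum of those of degree `m` that do not contain `X j` is the derivative of `esymm σ R (m + 1)`. -/
theorem MvPolynomial.pderiv_esymm_succ (j : σ) (m : ℕ) :
    pderiv j (esymm σ R (m + 1)) = esymm σ R m - X j * pderiv j (esymm σ R m) := by
  classical
  have hU : (Finset.univ : Finset σ) = insert j (Finset.univ.erase j) := by simp
  have hj : j ∉ (Finset.univ : Finset σ).erase j := by simp
  let E : ℕ → MvPolynomial σ R := fun k =>
    ∑ S ∈ ((Finset.univ : Finset σ).erase j).powersetCard k, ∏ i ∈ S, X i
  have hE : ∀ k, pderiv j (E k) = 0 := by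
    intro k
    refine pderiv_eq_zero_of_notMem_vars fun h => ?_
    obtain ⟨S, hS, hjS⟩ := Finset.mem_biUnion.1 (vars_sum_subset _ _ h)
    obtain ⟨i, hi, hji⟩ := Finset.mem_biUnion.1 (vars_prod _ hjS)
    have hij : j = i := by
      rcases subsingleton_or_nontrivial R with _ | _
      · have h0 : (X i : MvPolynomial σ R) = 0 := Subsingleton.elim _ _
        simp [h0] at hji
      · simpa using hji
    exact hj ((Finset.mem_powersetCard.1 hS).1 (hij ▸ hi))
  have hsucc : ∀ k, esymm σ R (k + 1) = E (k + 1) + X j * E k := by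
    intro k
    rw [esymm, hU, Finset.powersetCard_succ_insert hj, Finset.sum_union, Finset.sum_image,
      Finset.mul_sum]
    · refine congrArg _ (Finset.sum_congr rfl fun S hS => ?_)
      exact Finset.prod_insert fun h => hj ((Finset.mem_powersetCard.1 hS).1 h)
    · intro S hS T hT hST
      have hS' : j ∉ S := fun h => hj ((Finset.mem_powersetCard.1 hS).1 h)
      have hT' : j ∉ T := fun h => hj ((Finset.mem_powersetCard.1 hT).1 h)
      rw [← Finset.erase_insert hS', hST, Finset.erase_insert hT']
    · refine Finset.disjoint_left.2 fun S hS hS' => ?_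
      obtain ⟨T, -, rfl⟩ := Finset.mem_image.1 hS'
      exact hj ((Finset.mem_powersetCard.1 hS).1 (Finset.mem_insert_self j T))
  have hder : ∀ k, pderiv j (esymm σ R (k + 1)) = E k := by
    intro k
    rw [hsucc, map_add, Derivation.leibniz, hE, hE, pderiv_X_self]
    simp
  rw [hder]
  cases m with
  | zero => simp [E, esymm_zero]
  | succ k => rw [hder, hsucc]; ring

/-- Modulo `esymm 1, …, esymm m`, the derivative of `esymm (m + 1)` with respect to `X j` is
`(-X j) ^ m`. -/
theorem MvPolynomial.pderiv_esymm_sub_mem (I : Ideal (MvPolynomial σ R)) (j : σ) (m : ℕ)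
    (hI : ∀ i, 1 ≤ i → i ≤ m → esymm σ R i ∈ I) :
    pderiv j (esymm σ R (m + 1)) - (-X j) ^ m ∈ I := by
  induction m with
  | zero => rw [pderiv_esymm_succ]; simp [esymm_zero]
  | succ k ih =>
    have h1 := ih fun i hi hik => hI i hi (by omega)
    have h2 := hI (k + 1) (by omega) le_rfl
    have : pderiv j (esymm σ R (k + 1 + 1)) - (-X j) ^ (k + 1) = esymm σ R (k + 1) -
        X j * (pderiv j (esymm σ R (k + 1)) - (-X j) ^ k) := by
      rw [pderiv_esymm_succ j (k + 1)]; ring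
    rw [this]
    exact I.sub_mem h2 (I.mul_mem_left _ h1)

theorem MvPolynomial.constantCoeff_esymm {m : ℕ} (hm : m ≠ 0) :
    constantCoeff (esymm σ R m) = 0 := by
  rw [esymm, map_sum]
  refine Finset.sum_eq_zero fun S hS => ?_
  obtain ⟨i, hi⟩ : S.Nonempty := by
    rw [← Finset.card_ne_zero, (Finset.mem_powersetCard.1 hS).2]; exact hm
  rw [map_prod]
  exact Finset.prod_eq_zero hi (constantCoeff_X R i)

end Esymm

/-! ### Dimension theory of polynomial rings -/

theorem MvPolynomial.totalDegree_pderiv_lt {σ R : Type*} [CommSemiring R] (j : σ)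
    (p : MvPolynomial σ R) {m : ℕ} (hp : p.totalDegree ≤ m) (hm : 0 < m) :
    (pderiv j p).totalDegree < m := by
  classical
  rw [totalDegree, Finset.sup_lt_iff hm]
  intro s hs
  rw [mem_support_iff, coeff_pderiv] at hs
  have h := le_totalDegree (p := p) (mem_support_iff.2 (left_ne_zero_of_mul hs))
  change (s + Finsupp.single j 1).degree ≤ _ at h
  change s.degree < m
  simp only [map_add, Finsupp.degree_single] at h
  omega

/-- The ideal of the origin of affine `n`-space has height at least `n`: the kernels of the maps
killing the first `i` variables form a strictly increasing chain of primes. -/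
theorem MvPolynomial.le_height_ker_constantCoeff (F : Type*) [Field F] (n : ℕ) :
    (n : ℕ∞) ≤ (RingHom.ker (constantCoeff (σ := Fin n) (R := F))).height := by
  let φ : ℕ → MvPolynomial (Fin n) F →ₐ[F] MvPolynomial (Fin n) F := fun i =>
    aeval fun j => if (j : ℕ) < i then 0 else X j
  have hφ : ∀ i j, φ i (X j) = if (j : ℕ) < i then 0 else X j := fun i j => by simp [φ]
  have hcomp : ∀ i, (φ (i + 1)).comp (φ i) = φ (i + 1) := by
    intro i
    ext1 j
    rw [AlgHom.comp_apply, hφ]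
    split_ifs with h
    · rw [map_zero, hφ, if_pos (by omega)]
    · rfl
  have hchain : ∀ i, i ≤ n → (i : ℕ∞) ≤ (RingHom.ker (φ i)).height := by
    intro i
    induction i with
    | zero => simp
    | succ i ih =>
      intro hi
      have hlt : RingHom.ker (φ i) < RingHom.ker (φ (i + 1)) := by
        refine lt_of_le_of_ne (fun p hp => ?_) fun heq => ?_
        · rw [RingHom.mem_ker] at hp ⊢
          rw [← hcomp i, AlgHom.comp_apply, hp, map_zero]
        · have h1 : (X ⟨i, hi⟩ : MvPolynomial (Fin n) F) ∈ RingHom.ker (φ (i + 1)) := by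
            rw [RingHom.mem_ker, hφ, if_pos (by simp)]
          rw [← heq, RingHom.mem_ker, hφ, if_neg (by simp)] at h1
          exact X_ne_zero _ h1
      have : (RingHom.ker (φ i)).IsPrime := RingHom.ker_isPrime _
      have : (RingHom.ker (φ (i + 1))).IsPrime := RingHom.ker_isPrime _
      push_cast
      exact (add_le_add_left (ih (by omega)) 1).trans
        (Ideal.height_add_one_le_of_lt_of_isPrime hlt)
  refine (hchain n le_rfl).trans (Ideal.height_mono fun p hp => ?_)
  have h0 : constantCoeff (σ := Fin n) (R := F) =
      constantCoeff.comp (φ n : MvPolynomial (Fin n) F →+* MvPolynomial (Fin n) F) := by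
    refine MvPolynomial.ringHom_ext (fun a => ?_) fun j => ?_
    · simp [φ]
    · simp [hφ]
  rw [RingHom.mem_ker] at hp ⊢
  rw [h0, RingHom.comp_apply]
  exact (congrArg _ hp).trans (map_zero _)

/-- If, modulo `K`, the `m`-th power of every variable is a polynomial of degree below `m`, then
the quotient by `K` is finite-dimensional, because every monomial of large degree can be rewritten
in terms of monomials of smaller degree. -/
theorem MvPolynomial.finite_quotient_of_pow_sub_mem {σ F : Type*} [Finite σ] [Field F]
    (K : Ideal (MvPolynomial σ F)) (m : ℕ) (r : σ → MvPolynomial σ F)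
    (hr : ∀ j, (r j).totalDegree < m) (hK : ∀ j, X j ^ m - r j ∈ K) :
    Module.Finite F (MvPolynomial σ F ⧸ K) := by
  classical
  have := Fintype.ofFinite σ
  let N : ℕ := Fintype.card σ * m
  let T : Set (σ →₀ ℕ) := {s | s.degree ≤ N}
  have hT : T.Finite := Finsupp.finite_of_degree_le N
  let q : MvPolynomial σ F →ₗ[F] MvPolynomial σ F ⧸ K := (Ideal.Quotient.mkₐ F K).toLinearMap
  let W : Submodule F (MvPolynomial σ F ⧸ K) :=
    Submodule.span F ((fun s => q (monomial s 1)) '' T)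
  have hmon : ∀ D : ℕ, ∀ s : σ →₀ ℕ, s.degree ≤ D → q (monomial s 1) ∈ W := by
    intro D
    induction D with
    | zero =>
      intro s hs
      exact Submodule.subset_span ⟨s, hs.trans (Nat.zero_le _), rfl⟩
    | succ D ih =>
      intro s hs
      by_cases hsN : s.degree ≤ N
      · exact Submodule.subset_span ⟨s, hsN, rfl⟩
      obtain ⟨j, hj⟩ : ∃ j, m ≤ s j := by
        by_contra! h
        refine hsN ?_
        rw [Finsupp.degree_eq_sum]
        refine (Finset.sum_le_card_nsmul _ _ m fun j _ => (h j).le).trans ?_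
        simp [N]
      obtain ⟨u, rfl⟩ : ∃ u, s = u + Finsupp.single j m :=
        ⟨s - Finsupp.single j m, (tsub_add_cancel_of_le (by simpa using hj)).symm⟩
      have hq : q (monomial (u + Finsupp.single j m) 1) = q (monomial u 1 * r j) := by
        refine Ideal.Quotient.eq.2 ?_
        have : monomial (u + Finsupp.single j m) (1 : F) - monomial u 1 * r j =
            monomial u 1 * (X j ^ m - r j) := by
          rw [mul_sub, X_pow_eq_monomial, monomial_mul, one_mul]
        rw [this]
        exact K.mul_mem_left _ (hK j)
      rw [hq, (monomial u (1 : F) * r j).as_sum, map_sum]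
      refine Submodule.sum_mem _ fun v hv => ?_
      have hv' : v.degree ≤ D := by
        have h1 : v.degree ≤ _ := le_totalDegree hv
        have h2 := totalDegree_mul (monomial u (1 : F)) (r j)
        have h3 : (monomial u (1 : F)).totalDegree ≤ u.degree := totalDegree_monomial_le _ _
        have h4 := hr j
        simp only [map_add, Finsupp.degree_single] at hs
        omega
      have : monomial v (coeff v (monomial u (1 : F) * r j)) =
          coeff v (monomial u (1 : F) * r j) • monomial v 1 := by
        rw [smul_monomial, smul_eq_mul, mul_one]
      rw [this, map_smul]
      exact W.smul_mem _ (ih v hv')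
  have hW : W = ⊤ := by
    refine eq_top_iff.2 fun y _ => ?_
    obtain ⟨p, rfl⟩ := Ideal.Quotient.mk_surjective y
    change q p ∈ W
    rw [p.as_sum, map_sum]
    refine Submodule.sum_mem _ fun v _ => ?_
    have : monomial v (coeff v p) = coeff v p • monomial v 1 := by
      rw [smul_monomial, smul_eq_mul, mul_one]
    rw [this, map_smul]
    exact W.smul_mem _ (hmon _ v le_rfl)
  exact ⟨hW ▸ Submodule.fg_span (hT.image _)⟩

/-- If the common zeros of a set of polynomials vanishing at the origin of affine `n`-space form
a finite set, in the sense that the quotient is finite-dimensional, then the set has at least `n`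
elements, by Krull's height theorem. -/
theorem MvPolynomial.le_card_of_finite_quotient {F : Type*} [Field F] {n : ℕ}
    (S : Finset (MvPolynomial (Fin n) F)) (hS : ∀ p ∈ S, constantCoeff p = 0)
    [Module.Finite F (MvPolynomial (Fin n) F ⧸ Ideal.span (S : Set (MvPolynomial (Fin n) F)))] :
    n ≤ S.card := by
  have : (RingHom.ker (constantCoeff (σ := Fin n) (R := F))).IsPrime := RingHom.ker_isPrime _
  have hle : Ideal.span (S : Set (MvPolynomial (Fin n) F)) ≤ RingHom.ker constantCoeff :=
    Ideal.span_le.2 fun p hp => hS p hp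
  have hmin : RingHom.ker (constantCoeff (σ := Fin n) (R := F)) ∈
      (Ideal.span (S : Set (MvPolynomial (Fin n) F))).minimalPrimes := by
    refine ⟨⟨inferInstance, hle⟩, fun p hp hpm => ?_⟩
    have := hp.1
    -- A prime above the span is maximal, being the kernel of a map to a finite-dimensional domain.
    have : Module.Finite F (MvPolynomial (Fin n) F ⧸ p) :=
      Module.Finite.of_surjective (Ideal.Quotient.factorₐ F hp.2).toLinearMap
        (Ideal.Quotient.factor_surjective hp.2)
    have hfield : IsField (MvPolynomial (Fin n) F ⧸ p) :=
      isField_of_isIntegral_of_isField' (Field.toIsField F)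
    have : p.IsMaximal := Ideal.Quotient.maximal_of_isField p hfield
    exact (Ideal.IsMaximal.eq_of_le this (Ideal.IsPrime.ne_top inferInstance) hpm).ge
  exact_mod_cast (le_height_ker_constantCoeff F n).trans
    (Ideal.height_le_card_of_mem_minimalPrimes_span_finset hmin)

/-- If `esymm d` is a sum of `L.length` products of polynomials vanishing at the origin, up to an
error of degree below `d`, then `n ≤ 2 * L.length + (d - 1)`. Indeed all the partial derivatives of
the sum of products lie in the ideal generated by the factors; adding `esymm 1, …, esymm (d - 1)` to
the generators makes these derivatives `± X j ^ (d - 1)`, up to an error of smaller degree. -/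
theorem MvPolynomial.le_of_esymm_eq_sum_mul_add {F : Type*} [Field F] {n d : ℕ} (hd : 2 ≤ d)
    (L : List (MvPolynomial (Fin n) F × MvPolynomial (Fin n) F)) (R : MvPolynomial (Fin n) F)
    (hL : ∀ p ∈ L, constantCoeff p.1 = 0 ∧ constantCoeff p.2 = 0) (hR : R.totalDegree < d)
    (h : esymm (Fin n) F d = (L.map fun p => p.1 * p.2).sum + R) :
    n ≤ 2 * L.length + (d - 1) := by
  classical
  obtain ⟨m, rfl⟩ : ∃ m, d = m + 1 := ⟨d - 1, by omega⟩
  let S₁ : Finset (MvPolynomial (Fin n) F) := (L.map Prod.fst).toFinset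
  let S₂ : Finset (MvPolynomial (Fin n) F) := (L.map Prod.snd).toFinset
  let S₃ : Finset (MvPolynomial (Fin n) F) := (Finset.Icc 1 m).image (esymm (Fin n) F)
  let S := S₁ ∪ S₂ ∪ S₃
  let K : Ideal (MvPolynomial (Fin n) F) := Ideal.span (S : Set (MvPolynomial (Fin n) F))
  have hcard : S.card ≤ 2 * L.length + m := by
    have h1 : S₁.card ≤ L.length := by simpa using List.toFinset_card_le (L.map Prod.fst)
    have h2 : S₂.card ≤ L.length := by simpa using List.toFinset_card_le (L.map Prod.snd)
    have h3 : S₃.card ≤ m := by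
      simpa using Finset.card_image_le (s := Finset.Icc 1 m) (f := esymm (Fin n) F)
    have h4 := Finset.card_union_le (S₁ ∪ S₂) S₃
    have h5 := Finset.card_union_le S₁ S₂
    change (S₁ ∪ S₂ ∪ S₃).card ≤ _
    omega
  have hS : ∀ p ∈ S, constantCoeff p = 0 := by
    intro p hp
    simp only [S, S₁, S₂, S₃, Finset.mem_union, List.mem_toFinset, List.mem_map,
      Finset.mem_image, Finset.mem_Icc] at hp
    rcases hp with (⟨x, hx, rfl⟩ | ⟨x, hx, rfl⟩) | ⟨i, hi, rfl⟩
    · exact (hL x hx).1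
    · exact (hL x hx).2
    · exact constantCoeff_esymm (by omega)
  have hsum : ∀ (j : Fin n) (L' : List (MvPolynomial (Fin n) F × MvPolynomial (Fin n) F)),
      (∀ p ∈ L', p.1 ∈ K ∧ p.2 ∈ K) → pderiv j (L'.map fun p => p.1 * p.2).sum ∈ K := by
    intro j L'
    induction L' with
    | nil => simp
    | cons p L' ih =>
      intro hL'
      have hp := hL' p (by simp)
      rw [List.map_cons, List.sum_cons, map_add, pderiv_mul]
      exact K.add_mem (K.add_mem (K.mul_mem_left _ hp.2) (K.mul_mem_right _ hp.1))
        (ih fun q hq => hL' q (by simp [hq]))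
  have hLK : ∀ p ∈ L, p.1 ∈ K ∧ p.2 ∈ K := fun p hp =>
    ⟨Ideal.subset_span (by simp only [S, S₁, Finset.coe_union]; left; left; simpa using ⟨_, hp⟩),
      Ideal.subset_span (by simp only [S, S₂, Finset.coe_union]; left; right; simpa using ⟨_, hp⟩)⟩
  have hK : ∀ j : Fin n, X j ^ m - (-1) ^ m * pderiv j R ∈ K := by
    intro j
    have h1 := pderiv_esymm_sub_mem K j m fun i hi him => Ideal.subset_span (by
      simp only [S, S₃, Finset.coe_union]; right
      exact Finset.mem_coe.2 (Finset.mem_image_of_mem _ (Finset.mem_Icc.2 ⟨hi, him⟩)))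
    rw [h, map_add] at h1
    have h2 := K.mul_mem_left ((-1) ^ m) (K.sub_mem (hsum j L hLK) h1)
    have h3 : ((-1) ^ m * (-1) ^ m : MvPolynomial (Fin n) F) = 1 := by
      rw [← mul_pow]; simp
    convert h2 using 1
    rw [neg_pow (X j : MvPolynomial (Fin n) F)]
    linear_combination (-X j ^ m) * h3
  have : Module.Finite F (MvPolynomial (Fin n) F ⧸ K) := by
    refine finite_quotient_of_pow_sub_mem K m (fun j => (-1) ^ m * pderiv j R) (fun j => ?_) hK
    have h1 : (pderiv j R).totalDegree < m := totalDegree_pderiv_lt j R (by omega) (by omega)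
    rcases neg_one_pow_eq_or (MvPolynomial (Fin n) F) m with h2 | h2 <;> simpa [h2] using h1
  exact (le_card_of_finite_quotient S hS).trans hcard

/-! ### Decomposing the polynomial computed by a formula -/

/-- `HasProductDecomposition t s f` says that `f` is a sum of `k` products and of a polynomial of
degree at most `r < t`, where `k * t + r ≤ s` and the second factors vanish at the origin and have
degree below `2 * t`. The list consists of the pairs of factors. -/
def HasProductDecomposition {σ R : Type*} [CommRing R] (t s : ℕ) (f : MvPolynomial σ R) : Prop :=
  ∃ (L : List (MvPolynomial σ R × MvPolynomial σ R)) (g : MvPolynomial σ R) (r : ℕ),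
    f = (L.map fun p => p.1 * p.2).sum + g ∧ L.length * t + r ≤ s ∧ r < t ∧ g.totalDegree ≤ r ∧
      ∀ p ∈ L, constantCoeff p.2 = 0 ∧ p.2.totalDegree < 2 * t

namespace HasProductDecomposition

variable {σ R : Type*} [CommRing R] {t s s' : ℕ} {f f' : MvPolynomial σ R}

/-- A remainder of degree between `t` and `2 * t` can be turned, up to its constant term, into a
product with first factor `1`. -/
theorem of_totalDegree_lt_two_mul {L : List (MvPolynomial σ R × MvPolynomial σ R)}
    {g : MvPolynomial σ R} {r : ℕ} (hf : f = (L.map fun p => p.1 * p.2).sum + g)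
    (hs : L.length * t + r ≤ s) (hr : r < 2 * t) (hg : g.totalDegree ≤ r)
    (hL : ∀ p ∈ L, constantCoeff p.2 = 0 ∧ p.2.totalDegree < 2 * t) :
    HasProductDecomposition t s f := by
  rcases lt_or_ge r t with hrt | hrt
  · exact ⟨L, g, r, hf, hs, hrt, hg, hL⟩
  · refine ⟨(1, g - C (constantCoeff g)) :: L, C (constantCoeff g), 0, ?_, ?_, by omega, by simp,
      ?_⟩
    · rw [hf, List.map_cons, List.sum_cons]; ring
    · rw [List.length_cons, add_mul]; omega
    · intro p hp
      rcases List.mem_cons.1 hp with rfl | hp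
      · refine ⟨by simp, lt_of_le_of_lt (totalDegree_sub _ _) ?_⟩
        rw [totalDegree_C]; omega
      · exact hL p hp

theorem C (ht : 0 < t) (a : R) : HasProductDecomposition t 0 (C a : MvPolynomial σ R) :=
  ⟨[], MvPolynomial.C a, 0, by simp, by simp, ht, by simp, by simp⟩

theorem X (ht : 0 < t) (i : σ) : HasProductDecomposition t 1 (X i : MvPolynomial σ R) := by
  refine of_totalDegree_lt_two_mul (L := []) (r := 1) (by simp; rfl) (by simp) (by omega) ?_
    (by simp)
  exact (totalDegree_monomial_le _ _).trans (by simp)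

theorem add (h : HasProductDecomposition t s f) (h' : HasProductDecomposition t s' f') :
    HasProductDecomposition t (s + s') (f + f') := by
  obtain ⟨L, g, r, hf, hs, hr, hg, hL⟩ := h
  obtain ⟨L', g', r', hf', hs', hr', hg', hL'⟩ := h'
  refine ⟨L ++ L', g + g', max r r', ?_, ?_, by omega,
    (totalDegree_add _ _).trans (max_le_max hg hg'), ?_⟩
  · rw [hf, hf', List.map_append, List.sum_append]; ring
  · rw [List.length_append, add_mul]; omega
  · intro p hp
    exact (List.mem_append.1 hp).elim (hL p) (hL' p)

/-- Expanding `(∑ A B + g) * f'` with `f' = ∑ A' B' + g'` gives the products `(A f') B` and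
`(g A') B'`, and the remainder `g g'`, which has degree below `2 * t`. -/
theorem mul (h : HasProductDecomposition t s f) (h' : HasProductDecomposition t s' f') :
    HasProductDecomposition t (s + s') (f * f') := by
  obtain ⟨L, g, r, hf, hs, hr, hg, hL⟩ := h
  obtain ⟨L', g', r', hf', hs', hr', hg', hL'⟩ := h'
  refine of_totalDegree_lt_two_mul (L := (L.map fun p => (p.1 * f', p.2)) ++
    L'.map fun p => (g * p.1, p.2)) (g := g * g') (r := r + r') ?_ ?_ (by omega)
    ((totalDegree_mul _ _).trans (add_le_add hg hg')) ?_
  · have h1 : ((L.map fun p => (p.1 * f', p.2)).map fun p => p.1 * p.2).sum =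
        (L.map fun p => p.1 * p.2).sum * f' := by
      rw [List.map_map, ← List.sum_map_mul_right]
      refine congrArg _ (List.map_congr_left fun p _ => ?_)
      simp only [Function.comp_apply]; ring
    have h2 : ((L'.map fun p => (g * p.1, p.2)).map fun p => p.1 * p.2).sum =
        g * (L'.map fun p => p.1 * p.2).sum := by
      rw [List.map_map, ← List.sum_map_mul_left]
      refine congrArg _ (List.map_congr_left fun p _ => ?_)
      simp only [Function.comp_apply]; ring
    rw [List.map_append, List.sum_append, h1, h2, hf]
    linear_combination g * hf'
  · rw [List.length_append, List.length_map, List.length_map, add_mul]; omega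
  · intro p hp
    rcases List.mem_append.1 hp with hp | hp <;> obtain ⟨q, hq, rfl⟩ := List.mem_map.1 hp
    · exact hL q hq
    · exact hL' q hq

theorem sum (ht : 0 < t) {ι : Type*} (u : Finset ι) (s : ι → ℕ) (f : ι → MvPolynomial σ R)
    (h : ∀ i ∈ u, HasProductDecomposition t (s i) (f i)) :
    HasProductDecomposition t (∑ i ∈ u, s i) (∑ i ∈ u, f i) := by
  classical
  induction u using Finset.induction_on with
  | empty => simpa using C (σ := σ) ht (0 : R)
  | insert i u hi ih =>
    rw [Finset.sum_insert hi, Finset.sum_insert hi]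
    exact (h i (by simp)).add (ih fun j hj => h j (by simp [hj]))

theorem prod (ht : 0 < t) {ι : Type*} (u : Finset ι) (s : ι → ℕ) (f : ι → MvPolynomial σ R)
    (h : ∀ i ∈ u, HasProductDecomposition t (s i) (f i)) :
    HasProductDecomposition t (∑ i ∈ u, s i) (∏ i ∈ u, f i) := by
  classical
  induction u using Finset.induction_on with
  | empty => simpa using C (σ := σ) ht (1 : R)
  | insert i u hi ih =>
    rw [Finset.sum_insert hi, Finset.prod_insert hi]
    exact (h i (by simp)).mul (ih fun j hj => h j (by simp [hj]))

/-- The constant terms of the first factors can be moved into the remainder, since the second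
factors have degree below `2 * t`. -/
theorem exists_constantCoeff_eq_zero (h : HasProductDecomposition t s f) :
    ∃ (L : List (MvPolynomial σ R × MvPolynomial σ R)) (g : MvPolynomial σ R),
      f = (L.map fun p => p.1 * p.2).sum + g ∧ L.length * t ≤ s ∧ g.totalDegree < 2 * t ∧
        ∀ p ∈ L, constantCoeff p.1 = 0 ∧ constantCoeff p.2 = 0 := by
  obtain ⟨L, g, r, hf, hs, hr, hg, hL⟩ := h
  refine ⟨L.map fun p => (p.1 - MvPolynomial.C (constantCoeff p.1), p.2),
    (L.map fun p => MvPolynomial.C (constantCoeff p.1) * p.2).sum + g, ?_, ?_, ?_, ?_⟩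
  · rw [hf, ← add_assoc, List.map_map, ← List.sum_map_add]
    refine congrArg (· + g) (congrArg _ (List.map_congr_left fun p _ => ?_))
    simp only [Function.comp_apply]; ring
  · rw [List.length_map]; omega
  · refine lt_of_le_of_lt (totalDegree_add _ _) (max_lt ?_ (by omega))
    clear hf hs
    induction L with
    | nil => simp; omega
    | cons p L ih =>
      rw [List.map_cons, List.sum_cons]
      refine lt_of_le_of_lt (totalDegree_add _ _) (max_lt ?_ (ih fun q hq => hL q (by simp [hq])))
      refine lt_of_le_of_lt (totalDegree_mul _ _) ?_
      rw [totalDegree_C, zero_add]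
      exact (hL p (by simp)).2
  · intro p hp
    obtain ⟨q, hq, rfl⟩ := List.mem_map.1 hp
    exact ⟨by simp, (hL q hq).1⟩

end HasProductDecomposition

namespace AlgFormula

theorem hasProductDecomposition_eval {F σ : Type*} [CommRing F] {t : ℕ} (ht : 0 < t)
    (Φ : AlgFormula F σ) : HasProductDecomposition t Φ.size Φ.eval := by
  induction Φ with
  | const a => exact .C ht a
  | var i => exact .X ht i
  | sum k child ih => exact .sum ht _ _ _ fun j _ => ih j
  | prod k child ih => exact .prod ht _ _ _ fun j _ => ih j

theorem card_vars_eval_le_size {F σ : Type*} [CommSemiring F] [Nontrivial F] (Φ : AlgFormula F σ) :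
    Φ.eval.vars.card ≤ Φ.size := by
  classical
  induction Φ with
  | const a => simp [eval]
  | var i => simp [eval, size]
  | sum k child ih =>
    exact (Finset.card_le_card (vars_sum_subset _ _)).trans
      (Finset.card_biUnion_le.trans (Finset.sum_le_sum fun j _ => ih j))
  | prod k child ih =>
    exact (Finset.card_le_card (vars_prod _)).trans
      (Finset.card_biUnion_le.trans (Finset.sum_le_sum fun j _ => ih j))

end AlgFormula

theorem theorem1 :
    ∃ c : ℝ, 0 < c ∧
      ∀ (F : Type*) [Field F] (n d : ℕ), d ≤ n →
        ∀ Φ : AlgFormula F (Fin n), Φ.Computes (MvPolynomial.esymm (Fin n) F d) →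
          c * ((d : ℝ) * ((n : ℝ) - (d : ℝ))) ≤ (Φ.size : ℝ) := by
  refine ⟨1 / 6, by norm_num, fun F _ n d hdn Φ hΦ => ?_⟩
  have hΦ' : Φ.eval = esymm (Fin n) F d := hΦ
  obtain ⟨e, rfl⟩ : ∃ e, n = d + e := ⟨n - d, by omega⟩
  suffices h : d * e ≤ 6 * Φ.size by
    have : (d * e : ℝ) ≤ 6 * Φ.size := by exact_mod_cast h
    push_cast
    linarith
  rcases Nat.lt_or_ge d 2 with hd | hd
  · -- The decomposition needs `2 * t ≤ d` with `t > 0`; for `d = 1`, every variable must occur.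
    interval_cases d
    · simp
    · have h1 := Φ.card_vars_eval_le_size
      rw [hΦ', vars_def, degrees_esymm (Fin (1 + e)) F one_pos (by simp)] at h1
      simp at h1
      omega
  · have ht : 0 < d / 2 := by omega
    obtain ⟨L, g, hf, hs, hg, hL⟩ :=
      (Φ.hasProductDecomposition_eval ht).exists_constantCoeff_eq_zero
    have h1 := le_of_esymm_eq_sum_mul_add hd L g hL (by omega) (hΦ'.symm.trans hf)
    have h2 : e ≤ 2 * L.length := by omega
    have h3 : d ≤ 3 * (d / 2) := by omega
    calc d * e ≤ (3 * (d / 2)) * (2 * L.length) := Nat.mul_le_mul h3 h2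
      _ = 6 * (L.length * (d / 2)) := by ring
      _ ≤ 6 * Φ.size := Nat.mul_le_mul_left 6 hs
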